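/- \textbf{Theorem (Polytopal Legendre Function).} Let $1\le n<q$ and let $v_1,\dots,v_q\in\mathbb{R}^n$ be points (for instance, the vertices of a convex polytope) whose convex hull $P=\operatorname{conv}\{v_1,\dots,v_q\}$ has non-empty interior. Let $V\in\mathbb{R}^{n\times q}$ be the matrix with $i$-th column $v_i$, let $\Delta^{q-1}=\{\lambda\in\mathbb{R}^q:\lambda_i\ge 0,\ \sum_i\lambda_i=1\}$, and let $R_q(\lambda)=\sum_{i=1}^q\lambda_i\ln\lambda_i$ for $\lambda\in\Delta^{q-1}$ (with $0\ln 0=0$) and $R_q(\lambda)=+\infty$ for $\lambda\in\mathbb{R}^q\setminus\Delta^{q-1}$. Define $R:\mathbb{R}^n\to\mathbb{R}\cup\{+\infty\}$ by \[ R(x)=\inf\{R_q(\lambda):\lambda\in\Delta^{q-1},\ V\lambda=x\},\qquad \inf\emptyset=+\infty. \] For a function $f$ on $\mathbb{R}^m$ with values in $\mathbb{R}\cup\{+\infty\}$, write $\operatorname{dom}f=\{x: f(x)<+\infty\}$, $\partial f(x)=\{g: g\cdot(y-x)+f(x)\le f(y)\ \forall y\}$ and $f^*(y)=\sup_{x}\{x\cdot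 y-f(x)\}$. A proper convex function $f$ is of \emph{Legendre type} if (a) it is strictly convex on every convex subset of $\{x:\partial f(x)\ne\emptyset\}$, and (b) $\operatorname{int}\operatorname{dom}f\neq\emptyset$, $f$ is differentiable on $\operatorname{int}\operatorname{dom}f$, and $|\nabla f(x_k)|\to+\infty$ for every sequence $(x_k)$ in $\operatorname{int}\operatorname{dom}f$ converging to a point of $\partial\operatorname{dom}f$ (the topological boundary of $\operatorname{dom}f$). The function $f$ is \emph{superlinear} if $f(x)/|x|\to+\infty$ as $|x|\to+\infty$. Finally, $\operatorname{softmax}(z)_j=e^{z_j}/\sum_i e^{z_i}$ for $z\in\mathbb{R}^q$. Then: 1. $R$ is proper convex, of Legendre type and superlinear, and $\operatorname{dom}R=P$. 2. $R^*(y)=R_q^*(V^{T}y)$ for all $y\in\mathbb{R}^n$, where $R_q^*(z)=\ln\sum_{i=1}^q e^{z_i}$ and $\nabla R_q^*(z)=\operatorname{softmax}(z)$ for all $z\in\mathbb{R}^q$. 3. $R^*$ is differentiable on $\mathbb{R}^n$ with $\nabla R^*(y)=V\operatorname{softmax}(V^{T}y)$ and $\partial R^*(y)=\{\nabla R^*(y)\}$.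 The map $\nabla R^*$ is a homeomorphism from $\mathbb{R}^n$ onto $\operatorname{int}(P)$, whose inverse is $\nabla R:\operatorname{int}(P)\to\mathbb{R}^n$; moreover $\partial R(x)=\{\nabla R(x)\}$ for every $x\in\operatorname{int}(P)$. -/

import Mathlib

open Filter Topology

noncomputable section

namespace PolyLegendre

/-- The effective domain `dom f = {x | f x < +∞}`. -/
def effDom {n : ℕ} (f : EuclideanSpace ℝ (Fin n) → EReal) : Set (EuclideanSpace ℝ (Fin n)) :=
  {x | f x < ⊤}

/-- A proper convex function `ℝⁿ → ℝ ∪ {+∞}`: it never takes the value `-∞`, is finite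
somewhere, and satisfies the convexity inequality. -/
structure IsProperConvex {n : ℕ} (f : EuclideanSpace ℝ (Fin n) → EReal) : Prop where
  ne_bot : ∀ x, f x ≠ ⊥
  nonempty_dom : (effDom f).Nonempty
  convex : ∀ x y : EuclideanSpace ℝ (Fin n), ∀ a b : ℝ, 0 ≤ a → 0 ≤ b → a + b = 1 →
    f (a • x + b • y) ≤ (a : EReal) * f x + (b : EReal) * f y

/-- The subdifferential `∂f(x) = {g | g · (y - x) + f x ≤ f y for all y}`. -/
def subdifferential {n : ℕ} (f : EuclideanSpace ℝ (Fin n) → EReal)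
    (x : EuclideanSpace ℝ (Fin n)) : Set (EuclideanSpace ℝ (Fin n)) :=
  {g | ∀ y, ((inner ℝ g (y - x) : ℝ) : EReal) + f x ≤ f y}

/-- `f` is finite near `x` and (Fréchet) differentiable at `x` with gradient `g`. -/
def HasGradAt {n : ℕ} (f : EuclideanSpace ℝ (Fin n) → EReal)
    (g x : EuclideanSpace ℝ (Fin n)) : Prop :=
  (∀ᶠ z in 𝓝 x, f z ≠ ⊥ ∧ f z ≠ ⊤) ∧ HasGradientAt (fun z => (f z).toReal) g x

/-- `f` is strictly convex on every convex subset of `dom ∂f = {x | ∂f(x) ≠ ∅}`. -/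
def IsEssStrictlyConvex {n : ℕ} (f : EuclideanSpace ℝ (Fin n) → EReal) : Prop :=
  ∀ C : Set (EuclideanSpace ℝ (Fin n)), Convex ℝ C →
    C ⊆ {x | (subdifferential f x).Nonempty} →
    ∀ x ∈ C, ∀ y ∈ C, x ≠ y → ∀ a b : ℝ, 0 < a → 0 < b → a + b = 1 →
      f (a • x + b • y) < (a : EReal) * f x + (b : EReal) * f y

/-- `int (dom f)` is non-empty, `f` is differentiable on it, and the norm of the gradient tends
to infinity along every sequence in `int (dom f)` converging to a boundary point of `dom f`. -/
structure IsEssSmooth {n : ℕ} (f : EuclideanSpace ℝ (Fin n) → EReal) : Prop where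
  interior_nonempty : (interior (effDom f)).Nonempty
  differentiable : ∀ x ∈ interior (effDom f), ∃ g, HasGradAt f g x
  blowup : ∀ (u g : ℕ → EuclideanSpace ℝ (Fin n)) (x : EuclideanSpace ℝ (Fin n)),
    (∀ k, u k ∈ interior (effDom f)) → (∀ k, HasGradAt f (g k) (u k)) →
    x ∈ frontier (effDom f) → Tendsto u atTop (𝓝 x) →
    Tendsto (fun k => ‖g k‖) atTop atTop

/-- Functions of Legendre type. -/
structure IsLegendre {n : ℕ} (f : EuclideanSpace ℝ (Fin n) → EReal) : Prop where
  properConvex : IsProperConvex f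
  essStrictlyConvex : IsEssStrictlyConvex f
  essSmooth : IsEssSmooth f

/-- `f x / |x| → +∞` as `|x| → +∞`. -/
def IsSuperlinear {n : ℕ} (f : EuclideanSpace ℝ (Fin n) → EReal) : Prop :=
  Tendsto (fun x => f x / ((‖x‖ : ℝ) : EReal))
    (comap (fun x : EuclideanSpace ℝ (Fin n) => ‖x‖) atTop) (𝓝 ⊤)

/-- The convex conjugate `f*(y) = sup_x {x · y - f x}`. -/
def conjugate {n : ℕ} (f : EuclideanSpace ℝ (Fin n) → EReal)
    (y : EuclideanSpace ℝ (Fin n)) : EReal :=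
  ⨆ x, (((inner ℝ x y : ℝ) : EReal) - f x)

open Classical in
/-- The Gibbs entropy `R_q` on the standard simplex, extended by `+∞`
(the convention `0 ln 0 = 0` is automatic). -/
def gibbs (q : ℕ) (l : EuclideanSpace ℝ (Fin q)) : EReal :=
  if (fun i => l i) ∈ stdSimplex ℝ (Fin q) then
    ((∑ i, l i * Real.log (l i) : ℝ) : EReal)
  else ⊤

/-- The softmax function on `ℝ^q`. -/
def softmax {q : ℕ} (z : EuclideanSpace ℝ (Fin q)) : EuclideanSpace ℝ (Fin q) :=
  WithLp.toLp 2 fun j => Real.exp (z j) / ∑ i, Real.exp (z i)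

/-- The `n × q` matrix whose `i`-th column is `v i`. -/
def vertexMatrix {n q : ℕ} (v : Fin q → EuclideanSpace ℝ (Fin n)) :
    Matrix (Fin n) (Fin q) ℝ :=
  Matrix.of fun j i => v i j

/-- Matrix-vector multiplication between Euclidean spaces. -/
def mulVecE {m k : ℕ} (A : Matrix (Fin m) (Fin k) ℝ) (x : EuclideanSpace ℝ (Fin k)) :
    EuclideanSpace ℝ (Fin m) :=
  WithLp.toLp 2 (A.mulVec fun i => x i)

/-- `R(x) = inf {R_q(l) | l ∈ Δ^{q-1}, V l = x}`, with `inf ∅ = +∞`. -/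
def polyEntropy {n q : ℕ} (v : Fin q → EuclideanSpace ℝ (Fin n))
    (x : EuclideanSpace ℝ (Fin n)) : EReal :=
  sInf {r | ∃ l : EuclideanSpace ℝ (Fin q), (fun i => l i) ∈ stdSimplex ℝ (Fin q) ∧
    mulVecE (vertexMatrix v) l = x ∧ r = gibbs q l}

end PolyLegendre

end

namespace PolyLegendre

/-! `R` is the entropy of the simplex minimised over the fibres of `barycenter v`. Compactness makes
the minimum attained, so strict convexity of the entropy passes to `R` on all of `P`, and the
conjugate becomes log-sum-exp composed with `pairing v`. Gibbs' inequality is an equality at the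
softmax. This gives Fenchel–Young equality at `gradMap v y`, hence `y ∈ ∂R(∇R*(y))`
(`mem_subdifferential_polyEntropy_gradMap`). It remains to invert `∇R*`. It lands in `int P` because
softmax weights are positive; it is injective because minimisers are unique and `P` is
full-dimensional; it is onto because `R* - ⟨x, ·⟩` is coercive for `x` in `int P`. The same
coercivity makes it proper, hence a homeomorphism. Its continuous inverse selects subgradients of
`R`, which forces `R` to be differentiable, and compactness of images of balls gives the gradient
blow-up. -/

/-- Membership in the standard simplex, as a subset of Euclidean space. -/
def simplexE (q : ℕ) : Set (EuclideanSpace ℝ (Fin q)) :=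
  {l | (fun i => l i) ∈ stdSimplex ℝ (Fin q)}

/-- The real-valued entropy `∑ lᵢ log lᵢ`. -/
noncomputable def entropySum {q : ℕ} (l : EuclideanSpace ℝ (Fin q)) : ℝ :=
  ∑ i, l i * Real.log (l i)

/-- The log-sum-exp function. -/
noncomputable def logSumExp {q : ℕ} (z : EuclideanSpace ℝ (Fin q)) : ℝ :=
  Real.log (∑ i, Real.exp (z i))

/-- The point with barycentric weights `l`. -/
noncomputable def barycenter {n q : ℕ} (v : Fin q → EuclideanSpace ℝ (Fin n))
    (l : EuclideanSpace ℝ (Fin q)) : EuclideanSpace ℝ (Fin n) :=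
  ∑ i, l i • v i

/-- The vector of inner products of `y` with the points `v i`. -/
noncomputable def pairing {n q : ℕ} (v : Fin q → EuclideanSpace ℝ (Fin n))
    (y : EuclideanSpace ℝ (Fin n)) : EuclideanSpace ℝ (Fin q) :=
  WithLp.toLp 2 fun i => inner ℝ (v i) y

variable {n q : ℕ}

theorem mulVecE_vertexMatrix (v : Fin q → EuclideanSpace ℝ (Fin n))
    (l : EuclideanSpace ℝ (Fin q)) : mulVecE (vertexMatrix v) l = barycenter v l := by
  ext j
  simp [mulVecE, vertexMatrix, barycenter, Matrix.mulVec, dotProduct, mul_comm]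

theorem mulVecE_vertexMatrix_transpose (v : Fin q → EuclideanSpace ℝ (Fin n))
    (y : EuclideanSpace ℝ (Fin n)) : mulVecE (vertexMatrix v).transpose y = pairing v y := by
  ext j
  simp [mulVecE, vertexMatrix, pairing, Matrix.mulVec, dotProduct, PiLp.inner_apply, mul_comm]

theorem pairing_apply (v : Fin q → EuclideanSpace ℝ (Fin n)) (y : EuclideanSpace ℝ (Fin n))
    (i : Fin q) : pairing v y i = inner ℝ (v i) y := rfl

theorem inner_barycenter (v : Fin q → EuclideanSpace ℝ (Fin n))
    (l : EuclideanSpace ℝ (Fin q)) (y : EuclideanSpace ℝ (Fin n)) :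
    inner ℝ (barycenter v l) y = ∑ i, l i * inner ℝ (v i) y := by
  simp [barycenter, sum_inner, real_inner_smul_left]

theorem inner_eq_sum_mul (l z : EuclideanSpace ℝ (Fin q)) : inner ℝ l z = ∑ i, l i * z i := by
  simp [PiLp.inner_apply, mul_comm]

theorem inner_pairing (v : Fin q → EuclideanSpace ℝ (Fin n))
    (l : EuclideanSpace ℝ (Fin q)) (y : EuclideanSpace ℝ (Fin n)) :
    inner ℝ l (pairing v y) = inner ℝ (barycenter v l) y := by
  rw [inner_barycenter, inner_eq_sum_mul]
  rfl

theorem barycenter_combo (v : Fin q → EuclideanSpace ℝ (Fin n))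
    (l m : EuclideanSpace ℝ (Fin q)) (a b : ℝ) :
    barycenter v (a • l + b • m) = a • barycenter v l + b • barycenter v m := by
  simp [barycenter, add_smul, mul_smul, Finset.sum_add_distrib, Finset.smul_sum]

theorem continuous_barycenter (v : Fin q → EuclideanSpace ℝ (Fin n)) :
    Continuous (barycenter v) := by
  unfold barycenter
  fun_prop

theorem continuous_entropySum : Continuous (entropySum (q := q)) := by
  unfold entropySum
  refine continuous_finsetSum _ fun i _ => ?_
  exact Real.continuous_mul_log.comp (by fun_prop)

theorem convex_simplexE : Convex ℝ (simplexE q) := by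
  intro l hl m hm a b ha hb hab
  exact convex_stdSimplex ℝ (Fin q) hl hm ha hb hab

theorem isCompact_simplexE : IsCompact (simplexE q) := by
  have h := (EuclideanSpace.equiv (Fin q) ℝ).toHomeomorph.isCompact_preimage.2
    (isCompact_stdSimplex ℝ (Fin q))
  exact h

theorem convexHull_range_eq_barycenter_image (v : Fin q → EuclideanSpace ℝ (Fin n)) :
    convexHull ℝ (Set.range v) = barycenter v '' simplexE q := by
  classical
  apply subset_antisymm
  · refine convexHull_min ?_ ?_
    · rintro _ ⟨i, rfl⟩
      refine ⟨WithLp.toLp 2 (Pi.single i 1), single_mem_stdSimplex ℝ i, ?_⟩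
      simp [barycenter, Pi.single_apply]
    · rintro _ ⟨l, hl, rfl⟩ _ ⟨m, hm, rfl⟩ a b ha hb hab
      exact ⟨a • l + b • m, convex_simplexE hl hm ha hb hab, barycenter_combo v l m a b⟩
  · rintro _ ⟨l, hl, rfl⟩
    exact (convex_convexHull ℝ _).sum_mem (fun i _ => hl.1 i) hl.2
      fun i _ => subset_convexHull ℝ _ ⟨i, rfl⟩

theorem isCompact_convexHull_range (v : Fin q → EuclideanSpace ℝ (Fin n)) :
    IsCompact (convexHull ℝ (Set.range v)) := by
  rw [convexHull_range_eq_barycenter_image]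
  exact isCompact_simplexE.image (continuous_barycenter v)

/-! ### Entropy, softmax and log-sum-exp on the simplex. -/

theorem entropySum_nonpos {l : EuclideanSpace ℝ (Fin q)} (hl : l ∈ simplexE q) :
    entropySum l ≤ 0 :=
  Finset.sum_nonpos fun i _ => Real.mul_log_nonpos (hl.1 i)
    ((Finset.single_le_sum (fun j _ => hl.1 j) (Finset.mem_univ i)).trans_eq hl.2)

theorem entropySum_combo_lt {l m : EuclideanSpace ℝ (Fin q)} (hl : l ∈ simplexE q)
    (hm : m ∈ simplexE q) (hne : l ≠ m) {a b : ℝ} (ha : 0 < a) (hb : 0 < b) (hab : a + b = 1) :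
    entropySum (a • l + b • m) < a * entropySum l + b * entropySum m := by
  obtain ⟨i, hi⟩ : ∃ i, l i ≠ m i := by
    by_contra! h
    exact hne (by ext i; exact h i)
  unfold entropySum
  rw [Finset.mul_sum, Finset.mul_sum, ← Finset.sum_add_distrib]
  refine Finset.sum_lt_sum (fun j _ => ?_) ⟨i, Finset.mem_univ i, ?_⟩
  · exact Real.convexOn_mul_log.2 (hl.1 j) (hm.1 j) ha.le hb.le hab
  · exact Real.strictConvexOn_mul_log.2 (hl.1 i) (hm.1 i) hi ha hb hab

theorem sum_exp_pos [NeZero q] (z : EuclideanSpace ℝ (Fin q)) : 0 < ∑ i, Real.exp (z i) :=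
  Finset.sum_pos (fun _ _ => Real.exp_pos _) Finset.univ_nonempty

theorem softmax_apply (z : EuclideanSpace ℝ (Fin q)) (i : Fin q) :
    softmax z i = Real.exp (z i) / ∑ j, Real.exp (z j) := rfl

theorem softmax_pos [NeZero q] (z : EuclideanSpace ℝ (Fin q)) (i : Fin q) : 0 < softmax z i :=
  div_pos (Real.exp_pos _) (sum_exp_pos z)

theorem softmax_mem_simplexE [NeZero q] (z : EuclideanSpace ℝ (Fin q)) :
    softmax z ∈ simplexE q := by
  refine ⟨fun i => (softmax_pos z i).le, ?_⟩
  simp_rw [softmax_apply]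
  rw [← Finset.sum_div, div_self (sum_exp_pos z).ne']

theorem log_softmax [NeZero q] (z : EuclideanSpace ℝ (Fin q)) (i : Fin q) :
    Real.log (softmax z i) = z i - logSumExp z := by
  rw [softmax_apply, Real.log_div (Real.exp_pos _).ne' (sum_exp_pos z).ne', Real.log_exp,
    logSumExp]

theorem entropySum_softmax [NeZero q] (z : EuclideanSpace ℝ (Fin q)) :
    entropySum (softmax z) = inner ℝ (softmax z) z - logSumExp z := by
  have h : ∑ i, softmax z i = 1 := (softmax_mem_simplexE z).2
  simp_rw [entropySum, log_softmax, mul_sub, Finset.sum_sub_distrib, ← Finset.sum_mul, h,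
    inner_eq_sum_mul, one_mul]

/-- Gibbs' inequality. -/
theorem inner_sub_entropySum_le [NeZero q] (z : EuclideanSpace ℝ (Fin q))
    {l : EuclideanSpace ℝ (Fin q)} (hl : l ∈ simplexE q) :
    inner ℝ l z - entropySum l ≤ logSumExp z := by
  have h1 : ∑ i, l i = 1 := hl.2
  have h2 : ∑ i, softmax z i = 1 := (softmax_mem_simplexE z).2
  -- With `p` the softmax, this is `l log (p / l) ≤ p - l`, from `log t ≤ t - 1`; both `p` and `l`
  -- sum to 1, so the right sides cancel.
  have key : ∀ i, l i * (z i - logSumExp z - Real.log (l i)) ≤ softmax z i - l i := by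
    intro i
    rcases (hl.1 i).eq_or_lt with h0 | h0
    · have : l i = 0 := h0.symm
      simpa [this] using (softmax_pos z i).le
    · have h0 : 0 < l i := h0
      rw [← log_softmax, ← Real.log_div (softmax_pos z i).ne' h0.ne']
      have := Real.log_le_sub_one_of_pos (div_pos (softmax_pos z i) h0)
      calc _ ≤ l i * (softmax z i / l i - 1) := by gcongr
        _ = _ := by field_simp
  have hs := Finset.sum_le_sum fun i (_ : i ∈ Finset.univ) => key i
  simp_rw [mul_sub, Finset.sum_sub_distrib, ← Finset.sum_mul, h1, h2] at hs
  rw [inner_eq_sum_mul, entropySum]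
  linarith

theorem hasGradientAt_logSumExp [NeZero q] (z : EuclideanSpace ℝ (Fin q)) :
    HasGradientAt logSumExp (softmax z) z := by
  rw [hasGradientAt_iff_hasFDerivAt]
  have h : HasFDerivAt (fun z : EuclideanSpace ℝ (Fin q) => ∑ i, Real.exp (z i))
      (∑ i, Real.exp (z i) • (EuclideanSpace.proj i : EuclideanSpace ℝ (Fin q) →L[ℝ] ℝ)) z := by
    refine HasFDerivAt.fun_sum fun i _ => ?_
    exact (EuclideanSpace.proj i : EuclideanSpace ℝ (Fin q) →L[ℝ] ℝ).hasFDerivAt.exp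
  have e : InnerProductSpace.toDual ℝ _ (softmax z) = (∑ i, Real.exp (z i))⁻¹ •
      ∑ i, Real.exp (z i) • (EuclideanSpace.proj i : EuclideanSpace ℝ (Fin q) →L[ℝ] ℝ) := by
    ext w
    simp [inner_eq_sum_mul, softmax_apply, Finset.mul_sum, div_eq_inv_mul, mul_assoc]
  rw [e]
  exact h.log (sum_exp_pos z).ne'

theorem gibbs_of_mem {l : EuclideanSpace ℝ (Fin q)} (hl : l ∈ simplexE q) :
    gibbs q l = (entropySum l : EReal) := if_pos hl

theorem gibbs_of_notMem {l : EuclideanSpace ℝ (Fin q)} (hl : l ∉ simplexE q) :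
    gibbs q l = ⊤ := if_neg hl

theorem conjugate_gibbs [NeZero q] (z : EuclideanSpace ℝ (Fin q)) :
    conjugate (gibbs q) z = (logSumExp z : EReal) := by
  apply le_antisymm
  · refine iSup_le fun l => ?_
    by_cases hl : l ∈ simplexE q
    · rw [gibbs_of_mem hl]
      exact_mod_cast inner_sub_entropySum_le z hl
    · simp [gibbs_of_notMem hl]
  · refine le_iSup_of_le (softmax z) ?_
    rw [gibbs_of_mem (softmax_mem_simplexE z), entropySum_softmax]
    norm_cast
    linarith

theorem hasGradAt_of_coe {f : EuclideanSpace ℝ (Fin n) → EReal}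
    {F : EuclideanSpace ℝ (Fin n) → ℝ} (hf : ∀ y, f y = (F y : EReal))
    {g y : EuclideanSpace ℝ (Fin n)} (h : HasGradientAt F g y) : HasGradAt f g y := by
  refine ⟨Eventually.of_forall fun z => by simp [hf], ?_⟩
  simpa only [hf, EReal.toReal_coe] using h

theorem hasGradAt_conjugate_gibbs [NeZero q] (z : EuclideanSpace ℝ (Fin q)) :
    HasGradAt (conjugate (gibbs q)) (softmax z) z :=
  hasGradAt_of_coe conjugate_gibbs (hasGradientAt_logSumExp z)

/-! ### Gradients versus subgradients. -/

theorem HasGradAt.unique {f : EuclideanSpace ℝ (Fin n) → EReal}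
    {g h x : EuclideanSpace ℝ (Fin n)} (hg : HasGradAt f g x) (hh : HasGradAt f h x) : g = h :=
  hg.2.unique hh.2

/-- A subgradient at a point of differentiability is the gradient. -/
theorem HasGradAt.eq_of_mem_subdifferential {f : EuclideanSpace ℝ (Fin n) → EReal}
    {g h x : EuclideanSpace ℝ (Fin n)} (hg : HasGradAt f g x) (hh : h ∈ subdifferential f x) :
    h = g := by
  have hmin : IsLocalMin (fun z => (f z).toReal - inner ℝ h z) x := by
    have hx := hg.1.self_of_nhds
    filter_upwards [hg.1] with z hz
    have := hh z
    rw [← EReal.coe_toReal hz.2 hz.1, ← EReal.coe_toReal hx.2 hx.1] at this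
    norm_cast at this
    rw [inner_sub_right] at this
    linarith
  have hd : HasFDerivAt (fun z => (f z).toReal - inner ℝ h z)
      (InnerProductSpace.toDual ℝ _ g - InnerProductSpace.toDual ℝ _ h) x :=
    hg.2.hasFDerivAt.sub (InnerProductSpace.toDual ℝ _ h).hasFDerivAt
  have h0 := hmin.hasFDerivAt_eq_zero hd
  exact ((InnerProductSpace.toDual ℝ _).injective (sub_eq_zero.1 h0)).symm

theorem subdifferential_eq_singleton {f : EuclideanSpace ℝ (Fin n) → EReal}
    {g x : EuclideanSpace ℝ (Fin n)} (hg : HasGradAt f g x) (h : g ∈ subdifferential f x) :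
    subdifferential f x = {g} :=
  Set.eq_singleton_iff_unique_mem.2 ⟨h, fun _ hh => hg.eq_of_mem_subdifferential hh⟩

/-! ### The polytopal entropy: attainment, domain, convexity. -/

theorem polyEntropy_eq_iInf (v : Fin q → EuclideanSpace ℝ (Fin n))
    (x : EuclideanSpace ℝ (Fin n)) :
    polyEntropy v x = ⨅ l ∈ {l ∈ simplexE q | barycenter v l = x}, (entropySum l : EReal) := by
  unfold polyEntropy
  apply le_antisymm
  · refine le_iInf₂ fun l hl => sInf_le ⟨l, hl.1, ?_, (gibbs_of_mem hl.1).symm⟩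
    rw [mulVecE_vertexMatrix, hl.2]
  · refine le_sInf ?_
    rintro _ ⟨l, hl, hx, rfl⟩
    rw [gibbs_of_mem hl]
    exact iInf₂_le l ⟨hl, by rw [← mulVecE_vertexMatrix, hx]⟩

theorem polyEntropy_barycenter_le (v : Fin q → EuclideanSpace ℝ (Fin n))
    {l : EuclideanSpace ℝ (Fin q)} (hl : l ∈ simplexE q) :
    polyEntropy v (barycenter v l) ≤ entropySum l := by
  rw [polyEntropy_eq_iInf]
  exact iInf₂_le l ⟨hl, rfl⟩

theorem polyEntropy_of_notMem {v : Fin q → EuclideanSpace ℝ (Fin n)}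
    {x : EuclideanSpace ℝ (Fin n)} (hx : x ∉ convexHull ℝ (Set.range v)) :
    polyEntropy v x = ⊤ := by
  rw [polyEntropy_eq_iInf, iInf₂_eq_top]
  rintro l ⟨hl, rfl⟩
  rw [convexHull_range_eq_barycenter_image] at hx
  exact absurd ⟨l, hl, rfl⟩ hx

/-- The infimum defining `polyEntropy` is attained on the polytope. -/
theorem exists_polyEntropy_eq {v : Fin q → EuclideanSpace ℝ (Fin n)}
    {x : EuclideanSpace ℝ (Fin n)} (hx : x ∈ convexHull ℝ (Set.range v)) :
    ∃ l ∈ simplexE q, barycenter v l = x ∧ polyEntropy v x = (entropySum l : EReal) := by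
  rw [convexHull_range_eq_barycenter_image] at hx
  have hc : IsCompact {l ∈ simplexE q | barycenter v l = x} :=
    isCompact_simplexE.inter_right (isClosed_singleton.preimage (continuous_barycenter v))
  obtain ⟨l, hl, hmin⟩ := hc.exists_isMinOn hx continuous_entropySum.continuousOn
  refine ⟨l, hl.1, hl.2, ?_⟩
  rw [polyEntropy_eq_iInf]
  refine le_antisymm (iInf₂_le l hl) (le_iInf₂ fun m hm => ?_)
  exact_mod_cast hmin hm

theorem polyEntropy_ne_bot (v : Fin q → EuclideanSpace ℝ (Fin n))
    (x : EuclideanSpace ℝ (Fin n)) : polyEntropy v x ≠ ⊥ := by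
  by_cases hx : x ∈ convexHull ℝ (Set.range v)
  · obtain ⟨l, -, -, h⟩ := exists_polyEntropy_eq hx
    simp [h]
  · simp [polyEntropy_of_notMem hx]

theorem effDom_polyEntropy (v : Fin q → EuclideanSpace ℝ (Fin n)) :
    effDom (polyEntropy v) = convexHull ℝ (Set.range v) := by
  ext x
  by_cases hx : x ∈ convexHull ℝ (Set.range v)
  · obtain ⟨l, -, -, h⟩ := exists_polyEntropy_eq hx
    simp [effDom, h, hx]
  · simp [effDom, polyEntropy_of_notMem hx, hx]

/-- Strict convexity of the polytopal entropy on the whole polytope. -/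
theorem polyEntropy_combo_lt {v : Fin q → EuclideanSpace ℝ (Fin n)}
    {x y : EuclideanSpace ℝ (Fin n)} (hx : x ∈ convexHull ℝ (Set.range v))
    (hy : y ∈ convexHull ℝ (Set.range v)) (hne : x ≠ y) {a b : ℝ} (ha : 0 < a) (hb : 0 < b)
    (hab : a + b = 1) :
    polyEntropy v (a • x + b • y) < (a : EReal) * polyEntropy v x + b * polyEntropy v y := by
  obtain ⟨l, hl, rfl, hlx⟩ := exists_polyEntropy_eq hx
  obtain ⟨m, hm, rfl, hmy⟩ := exists_polyEntropy_eq hy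
  rw [hlx, hmy, ← barycenter_combo]
  -- Mixing the two minimisers gives a feasible weight for the mixed point.
  refine (polyEntropy_barycenter_le v (convex_simplexE hl hm ha.le hb.le hab)).trans_lt ?_
  exact_mod_cast entropySum_combo_lt hl hm (fun h => hne (by rw [h])) ha hb hab

theorem isProperConvex_polyEntropy {v : Fin q → EuclideanSpace ℝ (Fin n)}
    (hne : (convexHull ℝ (Set.range v)).Nonempty) : IsProperConvex (polyEntropy v) := by
  refine ⟨polyEntropy_ne_bot v, by rwa [effDom_polyEntropy], fun x y a b ha hb hab => ?_⟩
  -- Zero weights are separate: `0 * ⊤ = 0` in `EReal`.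
  rcases ha.eq_or_lt with rfl | ha
  · obtain rfl : b = 1 := by linarith
    simp
  rcases hb.eq_or_lt with rfl | hb
  · obtain rfl : a = 1 := by linarith
    simp
  -- Needed because `⊤ + ⊥ = ⊥` in `EReal`.
  have hbot : ∀ {c : ℝ} (z), 0 < c → (c : EReal) * polyEntropy v z ≠ ⊥ := by
    intro c z hc
    by_cases hz : z ∈ convexHull ℝ (Set.range v)
    · obtain ⟨l, -, -, h⟩ := exists_polyEntropy_eq hz
      rw [h, ← EReal.coe_mul]
      exact EReal.coe_ne_bot _
    · simp [polyEntropy_of_notMem hz, EReal.coe_mul_top_of_pos hc]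
  by_cases hx : x ∈ convexHull ℝ (Set.range v)
  swap
  · rw [polyEntropy_of_notMem hx, EReal.coe_mul_top_of_pos ha,
      EReal.top_add_of_ne_bot (hbot y hb)]
    exact le_top
  by_cases hy : y ∈ convexHull ℝ (Set.range v)
  swap
  · rw [polyEntropy_of_notMem hy, EReal.coe_mul_top_of_pos hb,
      EReal.add_top_of_ne_bot (hbot x ha)]
    exact le_top
  rcases eq_or_ne x y with rfl | hxy
  · obtain ⟨l, -, -, h⟩ := exists_polyEntropy_eq hx
    rw [← add_smul, hab, one_smul, h]
    norm_cast
    rw [← add_mul, hab, one_mul]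
  · exact (polyEntropy_combo_lt hx hy hxy ha hb hab).le

theorem mem_effDom_of_subdifferential_nonempty {f : EuclideanSpace ℝ (Fin n) → EReal}
    (hf : (effDom f).Nonempty) {x : EuclideanSpace ℝ (Fin n)}
    (hx : (subdifferential f x).Nonempty) : x ∈ effDom f := by
  obtain ⟨z, hz⟩ := hf
  obtain ⟨g, hg⟩ := hx
  refine lt_top_iff_ne_top (α := EReal).2 fun h => ?_
  have := hg z
  rw [h, EReal.coe_add_top] at this
  exact (this.trans_lt hz).false

theorem isEssStrictlyConvex_polyEntropy {v : Fin q → EuclideanSpace ℝ (Fin n)}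
    (hne : (convexHull ℝ (Set.range v)).Nonempty) : IsEssStrictlyConvex (polyEntropy v) := by
  intro C _ hC x hx y hy hxy a b ha hb hab
  rw [← effDom_polyEntropy] at hne
  have hmem : ∀ z ∈ C, z ∈ convexHull ℝ (Set.range v) := fun z hz =>
    effDom_polyEntropy v ▸ mem_effDom_of_subdifferential_nonempty hne (hC hz)
  exact polyEntropy_combo_lt (hmem x hx) (hmem y hy) hxy ha hb hab

/-- The domain is bounded, so the quotient is eventually the constant `⊤`. -/
theorem isSuperlinear_polyEntropy (v : Fin q → EuclideanSpace ℝ (Fin n)) :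
    IsSuperlinear (polyEntropy v) := by
  obtain ⟨C, hC⟩ := (isCompact_convexHull_range v).isBounded.exists_norm_le
  refine tendsto_const_nhds.congr' ?_
  filter_upwards [tendsto_comap.eventually (eventually_gt_atTop (max C 0))] with x hx
  have hx' := max_lt_iff.1 hx
  rw [polyEntropy_of_notMem fun h => (hC x h).not_gt hx'.1]
  exact (EReal.top_div_of_pos_ne_top (by exact_mod_cast hx'.2) (EReal.coe_ne_top _)).symm

/-! ### Duality: the conjugate and its gradient. -/

/-- The map `y ↦ V softmax(Vᵀ y)`. -/
noncomputable def gradMap (v : Fin q → EuclideanSpace ℝ (Fin n))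
    (y : EuclideanSpace ℝ (Fin n)) : EuclideanSpace ℝ (Fin n) :=
  barycenter v (softmax (pairing v y))

/-- A supremum over `x` followed by one over the fibre above `x` is a single supremum over the
simplex. -/
theorem conjugate_polyEntropy (v : Fin q → EuclideanSpace ℝ (Fin n))
    (y : EuclideanSpace ℝ (Fin n)) :
    conjugate (polyEntropy v) y = conjugate (gibbs q) (pairing v y) := by
  apply le_antisymm
  · refine iSup_le fun x => ?_
    by_cases hx : x ∈ convexHull ℝ (Set.range v)
    · obtain ⟨l, hl, rfl, h⟩ := exists_polyEntropy_eq hx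
      refine le_iSup_of_le l ?_
      rw [h, gibbs_of_mem hl, inner_pairing]
    · simp [polyEntropy_of_notMem hx]
  · refine iSup_le fun l => ?_
    by_cases hl : l ∈ simplexE q
    · refine le_iSup_of_le (barycenter v l) ?_
      rw [gibbs_of_mem hl, inner_pairing]
      exact EReal.sub_le_sub le_rfl (polyEntropy_barycenter_le v hl)
    · simp [gibbs_of_notMem hl]

theorem polyEntropy_nonpos {v : Fin q → EuclideanSpace ℝ (Fin n)}
    {x : EuclideanSpace ℝ (Fin n)} (hx : x ∈ convexHull ℝ (Set.range v)) :
    polyEntropy v x ≤ 0 := by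
  obtain ⟨l, hl, -, h⟩ := exists_polyEntropy_eq hx
  rw [h]
  exact_mod_cast entropySum_nonpos hl

variable [NeZero q]

theorem conjugate_polyEntropy_eq_coe (v : Fin q → EuclideanSpace ℝ (Fin n))
    (y : EuclideanSpace ℝ (Fin n)) :
    conjugate (polyEntropy v) y = (logSumExp (pairing v y) : EReal) := by
  rw [conjugate_polyEntropy, conjugate_gibbs]

/-- The Fenchel–Young inequality. -/
theorem inner_sub_le_polyEntropy (v : Fin q → EuclideanSpace ℝ (Fin n))
    (x y : EuclideanSpace ℝ (Fin n)) :
    ((inner ℝ x y - logSumExp (pairing v y) : ℝ) : EReal) ≤ polyEntropy v x := by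
  rw [polyEntropy_eq_iInf]
  refine le_iInf₂ ?_
  rintro l ⟨hl, rfl⟩
  have := inner_sub_entropySum_le (pairing v y) hl
  rw [inner_pairing] at this
  exact_mod_cast by linarith

/-- Equality in the Fenchel–Young inequality. -/
theorem polyEntropy_gradMap (v : Fin q → EuclideanSpace ℝ (Fin n))
    (y : EuclideanSpace ℝ (Fin n)) :
    polyEntropy v (gradMap v y) =
      ((inner ℝ (gradMap v y) y - logSumExp (pairing v y) : ℝ) : EReal) := by
  refine le_antisymm ?_ (inner_sub_le_polyEntropy v _ y)
  refine (polyEntropy_barycenter_le v (softmax_mem_simplexE _)).trans_eq ?_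
  rw [entropySum_softmax, inner_pairing, gradMap]

theorem mem_subdifferential_polyEntropy_gradMap (v : Fin q → EuclideanSpace ℝ (Fin n))
    (y : EuclideanSpace ℝ (Fin n)) : y ∈ subdifferential (polyEntropy v) (gradMap v y) := by
  intro x
  refine le_trans ?_ (inner_sub_le_polyEntropy v x y)
  rw [polyEntropy_gradMap]
  norm_cast
  rw [inner_sub_right, real_inner_comm x y, real_inner_comm (gradMap v y) y]
  linarith

theorem logSumExp_pairing_add_inner_le (v : Fin q → EuclideanSpace ℝ (Fin n))
    (y w : EuclideanSpace ℝ (Fin n)) :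
    logSumExp (pairing v y) + inner ℝ (gradMap v y) (w - y) ≤ logSumExp (pairing v w) := by
  have h := inner_sub_le_polyEntropy v (gradMap v y) w
  rw [polyEntropy_gradMap] at h
  norm_cast at h
  rw [inner_sub_right]
  linarith

theorem hasGradientAt_logSumExp_pairing (v : Fin q → EuclideanSpace ℝ (Fin n))
    (y : EuclideanSpace ℝ (Fin n)) :
    HasGradientAt (fun y => logSumExp (pairing v y)) (gradMap v y) y := by
  let L : EuclideanSpace ℝ (Fin n) →L[ℝ] EuclideanSpace ℝ (Fin q) :=
    LinearMap.toContinuousLinearMap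
      { toFun := pairing v
        map_add' := fun a b => by ext i; simp [pairing, inner_add_right]
        map_smul' := fun c a => by ext i; simp [pairing, inner_smul_right] }
  have h := (hasGradientAt_logSumExp (pairing v y)).hasFDerivAt.comp y L.hasFDerivAt
  rw [hasGradientAt_iff_hasFDerivAt]
  have e : InnerProductSpace.toDual ℝ _ (gradMap v y) =
      (InnerProductSpace.toDual ℝ _ (softmax (pairing v y))).comp L := by
    ext w
    exact (inner_pairing v _ w).symm
  rw [e]
  exact h

theorem hasGradAt_conjugate_polyEntropy (v : Fin q → EuclideanSpace ℝ (Fin n))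
    (y : EuclideanSpace ℝ (Fin n)) : HasGradAt (conjugate (polyEntropy v)) (gradMap v y) y :=
  hasGradAt_of_coe (conjugate_polyEntropy_eq_coe v) (hasGradientAt_logSumExp_pairing v y)

theorem subdifferential_conjugate_polyEntropy (v : Fin q → EuclideanSpace ℝ (Fin n))
    (y : EuclideanSpace ℝ (Fin n)) :
    subdifferential (conjugate (polyEntropy v)) y = {gradMap v y} := by
  refine subdifferential_eq_singleton (hasGradAt_conjugate_polyEntropy v y) fun w => ?_
  rw [conjugate_polyEntropy_eq_coe, conjugate_polyEntropy_eq_coe, add_comm]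
  exact_mod_cast logSumExp_pairing_add_inner_le v y w

theorem continuous_gradMap (v : Fin q → EuclideanSpace ℝ (Fin n)) : Continuous (gradMap v) := by
  refine (continuous_barycenter v).comp ((PiLp.continuous_toLp 2 _).comp ?_)
  refine continuous_pi fun i => Continuous.div ?_ ?_ fun y => (sum_exp_pos (pairing v y)).ne'
  · simp only [pairing_apply]; fun_prop
  · simp only [pairing_apply]; fun_prop

/-! ### `∇R*` is a homeomorphism onto the interior. -/

/-- Otherwise a functional separates the point from `int P`. A strictly positive average of its
vertex values then equals an upper bound for them, so the functional is constant on `P`,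
contradicting strict separation. -/
theorem gradMap_mem_interior {v : Fin q → EuclideanSpace ℝ (Fin n)}
    (hP : (interior (convexHull ℝ (Set.range v))).Nonempty) (y : EuclideanSpace ℝ (Fin n)) :
    gradMap v y ∈ interior (convexHull ℝ (Set.range v)) := by
  by_contra hx
  have hconv : Convex ℝ (convexHull ℝ (Set.range v)) := convex_convexHull ℝ _
  obtain ⟨f, hf⟩ := geometric_hahn_banach_open_point hconv.interior isOpen_interior hx
  have hle : ∀ i, f (v i) ≤ f (gradMap v y) := by
    intro i
    have hcl : v i ∈ closure (interior (convexHull ℝ (Set.range v))) := by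
      rw [hconv.closure_interior_eq_closure_of_nonempty_interior hP]
      exact subset_closure (subset_convexHull ℝ _ ⟨i, rfl⟩)
    exact closure_minimal (fun a ha => (hf a ha).le)
      (isClosed_le f.continuous continuous_const) hcl
  have hbary : ∀ l : EuclideanSpace ℝ (Fin q), f (barycenter v l) = ∑ i, l i * f (v i) := by
    intro l
    simp [barycenter]
  set p := softmax (pairing v y) with hp
  have hsum : ∑ i, p i = 1 := (softmax_mem_simplexE _).2
  have hzero : ∑ i, p i * (f (gradMap v y) - f (v i)) = 0 := by
    simp_rw [mul_sub, Finset.sum_sub_distrib, ← Finset.sum_mul, hsum, ← hbary]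
    simp [gradMap, hp]
  have heq : ∀ i, f (v i) = f (gradMap v y) := by
    intro i
    have h := (Finset.sum_eq_zero_iff_of_nonneg fun i _ =>
      mul_nonneg (softmax_pos (pairing v y) i).le (sub_nonneg.2 (hle i))).1 hzero i
      (Finset.mem_univ i)
    rcases mul_eq_zero.1 h with h | h
    · exact absurd h (softmax_pos _ i).ne'
    · linarith
  obtain ⟨z, hz⟩ := hP
  have hz' := interior_subset hz
  rw [convexHull_range_eq_barycenter_image] at hz'
  obtain ⟨l, hl, rfl⟩ := hz'
  refine (hf _ hz).ne ?_
  simp_rw [hbary, heq, ← Finset.sum_mul]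
  rw [show ∑ i, l i = 1 from hl.2, one_mul]

/-- Both weights minimise entropy over the same fibre; if distinct, their midpoint would do better.
-/
theorem softmax_pairing_eq_of_gradMap_eq {v : Fin q → EuclideanSpace ℝ (Fin n)}
    {y w : EuclideanSpace ℝ (Fin n)} (h : gradMap v y = gradMap v w) :
    softmax (pairing v y) = softmax (pairing v w) := by
  by_contra hne
  have hR : ∀ u, polyEntropy v (gradMap v u) = (entropySum (softmax (pairing v u)) : EReal) := by
    intro u
    rw [polyEntropy_gradMap, entropySum_softmax, inner_pairing, gradMap]
  have he : entropySum (softmax (pairing v y)) = entropySum (softmax (pairing v w)) := by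
    exact_mod_cast (hR y).symm.trans ((congrArg _ h).trans (hR w))
  have hhalf : (1 / 2 : ℝ) + 1 / 2 = 1 := by norm_num
  have h1 := entropySum_combo_lt (softmax_mem_simplexE _) (softmax_mem_simplexE _) hne
    (a := 1 / 2) (b := 1 / 2) (by norm_num) (by norm_num) hhalf
  have h2 := polyEntropy_barycenter_le v (convex_simplexE (softmax_mem_simplexE (pairing v y))
    (softmax_mem_simplexE (pairing v w)) (a := 1 / 2) (b := 1 / 2) (by norm_num) (by norm_num)
    hhalf)
  rw [barycenter_combo] at h2
  change polyEntropy v ((1 / 2 : ℝ) • gradMap v y + (1 / 2 : ℝ) • gradMap v w) ≤ _ at h2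
  rw [← h, ← add_smul, hhalf, one_smul, hR] at h2
  norm_cast at h2
  linarith

/-- Equal softmaxes differ in their logits by a constant, so `y - w` has constant pairing with `P`,
which has interior. -/
theorem gradMap_injective {v : Fin q → EuclideanSpace ℝ (Fin n)}
    (hP : (interior (convexHull ℝ (Set.range v))).Nonempty) : Function.Injective (gradMap v) := by
  intro y w h
  have hs := softmax_pairing_eq_of_gradMap_eq h
  set c := logSumExp (pairing v y) - logSumExp (pairing v w)
  have hc : ∀ i, inner ℝ (v i) (y - w) = c := by
    intro i
    have := congrArg (fun p : EuclideanSpace ℝ (Fin q) => Real.log (p i)) hs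
    simp only [log_softmax, pairing_apply] at this
    rw [inner_sub_right]
    linarith
  have hconst : ∀ z ∈ convexHull ℝ (Set.range v), inner ℝ z (y - w) = c := by
    intro z hz
    rw [convexHull_range_eq_barycenter_image] at hz
    obtain ⟨l, hl, rfl⟩ := hz
    simp_rw [inner_barycenter, hc, ← Finset.sum_mul]
    rw [show ∑ i, l i = 1 from hl.2, one_mul]
  obtain ⟨z, hz⟩ := hP
  have hloc : IsLocalMin (fun z => inner ℝ (y - w) z) z := by
    filter_upwards [mem_interior_iff_mem_nhds.1 hz] with u hu
    rw [real_inner_comm, real_inner_comm u, hconst u hu, hconst z (interior_subset hz)]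
  have h0 := hloc.hasFDerivAt_eq_zero (InnerProductSpace.toDual ℝ _ (y - w)).hasFDerivAt
  exact sub_eq_zero.1 ((map_eq_zero_iff _ (InnerProductSpace.toDual ℝ _).injective).1 h0)

/-- Coercivity of `R* - ⟨x, ·⟩` for `x` in the interior of the polytope. -/
theorem mul_norm_le_logSumExp_sub_inner {v : Fin q → EuclideanSpace ℝ (Fin n)}
    {x : EuclideanSpace ℝ (Fin n)} {r : ℝ} (hr : 0 ≤ r)
    (h : Metric.closedBall x r ⊆ convexHull ℝ (Set.range v)) (y : EuclideanSpace ℝ (Fin n)) :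
    r * ‖y‖ ≤ logSumExp (pairing v y) - inner ℝ x y := by
  have hy : r / ‖y‖ * ‖y‖ ^ 2 = r * ‖y‖ := by
    rcases eq_or_ne ‖y‖ 0 with h0 | h0
    · simp [h0]
    · field_simp
  -- Fenchel–Young is applied at the point of the ball farthest in direction `y`, where `R ≤ 0`. For
  -- `y = 0`, `r / 0 = 0` gives `x` itself.
  have hmem : x + (r / ‖y‖) • y ∈ convexHull ℝ (Set.range v) := by
    apply h
    rw [mem_closedBall_iff_norm, add_sub_cancel_left, norm_smul, Real.norm_of_nonneg (by positivity)]
    rcases eq_or_ne ‖y‖ 0 with h0 | h0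
    · simpa [h0] using hr
    · rw [div_mul_cancel₀ _ h0]
  have hle := (inner_sub_le_polyEntropy v _ y).trans (polyEntropy_nonpos hmem)
  norm_cast at hle
  rw [inner_add_left, real_inner_smul_left, real_inner_self_eq_norm_sq, hy] at hle
  linarith

/-- Points `y` whose image stays at distance `r` from the boundary are bounded; this is what makes
`gradMap` proper. -/
theorem mul_norm_le_of_closedBall_gradMap_subset {v : Fin q → EuclideanSpace ℝ (Fin n)}
    {y : EuclideanSpace ℝ (Fin n)} {r : ℝ} (hr : 0 ≤ r)
    (h : Metric.closedBall (gradMap v y) r ⊆ convexHull ℝ (Set.range v)) :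
    r * ‖y‖ ≤ logSumExp (pairing v 0) := by
  have h1 := mul_norm_le_logSumExp_sub_inner hr h y
  have h2 := logSumExp_pairing_add_inner_le v y 0
  rw [zero_sub, inner_neg_right] at h2
  linarith

/-- A minimiser of the coercive function `R* - ⟨x, ·⟩` is a critical point. -/
theorem exists_gradMap_eq {v : Fin q → EuclideanSpace ℝ (Fin n)}
    {x : EuclideanSpace ℝ (Fin n)} (hx : x ∈ interior (convexHull ℝ (Set.range v))) :
    ∃ y, gradMap v y = x := by
  obtain ⟨r, hr, hball⟩ := Metric.nhds_basis_closedBall.mem_iff.1 (mem_interior_iff_mem_nhds.1 hx)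
  have hd : ∀ y, HasFDerivAt (fun y => logSumExp (pairing v y) - inner ℝ x y)
      (InnerProductSpace.toDual ℝ _ (gradMap v y) - InnerProductSpace.toDual ℝ _ x) y := fun y =>
    (hasGradientAt_logSumExp_pairing v y).hasFDerivAt.sub
      (InnerProductSpace.toDual ℝ _ x).hasFDerivAt
  have hcont : Continuous fun y => logSumExp (pairing v y) - inner ℝ x y :=
    continuous_iff_continuousAt.2 fun y => (hd y).continuousAt
  have htend : Tendsto (fun y => logSumExp (pairing v y) - inner ℝ x y) (cocompact _) atTop :=
    tendsto_atTop_mono (mul_norm_le_logSumExp_sub_inner hr.le hball)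
      ((tendsto_norm_cocompact_atTop).const_mul_atTop hr)
  obtain ⟨y, hy⟩ := hcont.exists_forall_le htend
  have hmin : IsLocalMin (fun y => logSumExp (pairing v y) - inner ℝ x y) y :=
    Eventually.of_forall hy
  exact ⟨y, (InnerProductSpace.toDual ℝ _).injective
    (sub_eq_zero.1 (hmin.hasFDerivAt_eq_zero (hd y)))⟩

theorem isProperMap_codRestrict_gradMap {v : Fin q → EuclideanSpace ℝ (Fin n)}
    (hP : (interior (convexHull ℝ (Set.range v))).Nonempty) :
    IsProperMap (Set.codRestrict (gradMap v) (interior (convexHull ℝ (Set.range v)))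
      (gradMap_mem_interior hP)) := by
  have : LocallyCompactSpace (interior (convexHull ℝ (Set.range v))) :=
    isOpen_interior.locallyCompactSpace
  have hcont : Continuous (Set.codRestrict (gradMap v) _ (gradMap_mem_interior hP)) :=
    (continuous_gradMap v).codRestrict _
  refine isProperMap_iff_isCompact_preimage.2 ⟨hcont, fun K hK => ?_⟩
  have hsub : Subtype.val '' K ⊆ interior (convexHull ℝ (Set.range v)) := by
    rintro _ ⟨x, -, rfl⟩
    exact x.2
  obtain ⟨r, hr, hball⟩ :=
    (hK.image continuous_subtype_val).exists_cthickening_subset_open isOpen_interior hsub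
  refine (isCompact_closedBall 0 (logSumExp (pairing v 0) / r)).of_isClosed_subset
    (hK.isClosed.preimage hcont) fun y hy => ?_
  rw [mem_closedBall_zero_iff, le_div_iff₀' hr]
  refine mul_norm_le_of_closedBall_gradMap_subset hr.le ?_
  have hmem : gradMap v y ∈ Subtype.val '' K := ⟨_, hy, rfl⟩
  exact (Metric.closedBall_subset_cthickening hmem r).trans (hball.trans interior_subset)

/-- The homeomorphism `∇R*` from the whole space onto the interior of the polytope. -/
noncomputable def gradHomeomorph {v : Fin q → EuclideanSpace ℝ (Fin n)}
    (hP : (interior (convexHull ℝ (Set.range v))).Nonempty) :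
    EuclideanSpace ℝ (Fin n) ≃ₜ interior (convexHull ℝ (Set.range v)) :=
  (Equiv.ofBijective (Set.codRestrict (gradMap v) _ (gradMap_mem_interior hP))
    ⟨(gradMap_injective hP).codRestrict _, fun x => by
      obtain ⟨y, hy⟩ := exists_gradMap_eq x.2
      exact ⟨y, Subtype.ext hy⟩⟩).toHomeomorphOfContinuousClosed
    (isProperMap_codRestrict_gradMap hP).continuous (isProperMap_codRestrict_gradMap hP).isClosedMap

theorem coe_gradHomeomorph {v : Fin q → EuclideanSpace ℝ (Fin n)}
    (hP : (interior (convexHull ℝ (Set.range v))).Nonempty) (y : EuclideanSpace ℝ (Fin n)) :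
    (gradHomeomorph hP y : EuclideanSpace ℝ (Fin n)) = gradMap v y := rfl

theorem gradMap_gradHomeomorph_symm {v : Fin q → EuclideanSpace ℝ (Fin n)}
    (hP : (interior (convexHull ℝ (Set.range v))).Nonempty)
    (x : interior (convexHull ℝ (Set.range v))) :
    gradMap v ((gradHomeomorph hP).symm x) = x := by
  rw [← coe_gradHomeomorph hP, Homeomorph.apply_symm_apply]

theorem symm_mem_subdifferential_polyEntropy {v : Fin q → EuclideanSpace ℝ (Fin n)}
    (hP : (interior (convexHull ℝ (Set.range v))).Nonempty)
    (x : interior (convexHull ℝ (Set.range v))) :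
    (gradHomeomorph hP).symm x ∈ subdifferential (polyEntropy v) x := by
  have h := mem_subdifferential_polyEntropy_gradMap v ((gradHomeomorph hP).symm x)
  rwa [gradMap_gradHomeomorph_symm] at h

/-! ### Differentiability of `R` and boundary blow-up. -/

theorem hasGradAt_polyEntropy {v : Fin q → EuclideanSpace ℝ (Fin n)}
    (hP : (interior (convexHull ℝ (Set.range v))).Nonempty)
    (x : interior (convexHull ℝ (Set.range v))) :
    HasGradAt (polyEntropy v) ((gradHomeomorph hP).symm x) x := by
  have hfin : ∀ z : interior (convexHull ℝ (Set.range v)),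
      ((polyEntropy v z).toReal : EReal) = polyEntropy v z := fun z => by
    obtain ⟨l, -, -, h⟩ := exists_polyEntropy_eq (interior_subset z.2)
    rw [h, EReal.toReal_coe]
  have hsub : ∀ z w : interior (convexHull ℝ (Set.range v)),
      inner ℝ ((gradHomeomorph hP).symm z) ((w : EuclideanSpace ℝ (Fin n)) - z) +
        (polyEntropy v z).toReal ≤ (polyEntropy v w).toReal := fun z w => by
    have h := symm_mem_subdifferential_polyEntropy hP z w
    rw [← hfin z, ← hfin w] at h
    exact_mod_cast h
  refine ⟨?_, ?_⟩
  · filter_upwards [isOpen_interior.mem_nhds x.2] with z hz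
    have h := hfin ⟨z, hz⟩
    exact ⟨h ▸ EReal.coe_ne_bot _, h ▸ EReal.coe_ne_top _⟩
  -- With `g` the inverse map, the subgradient inequalities at `x` and `z` trap the remainder
  -- between 0 and `⟨g z - g x, z - x⟩`, which is `o(‖z - x‖)` by continuity of `g`. Passing to the
  -- subtype makes that continuity available.
  · rw [hasGradientAt_iff_isLittleO, ← isOpen_interior.isOpenEmbedding_subtypeVal.map_nhds_eq,
      Asymptotics.isLittleO_map, Asymptotics.isLittleO_iff]
    intro ε hε
    have hcont := (gradHomeomorph hP).symm.continuous.tendsto x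
    filter_upwards [hcont.eventually (Metric.closedBall_mem_nhds _ hε)] with z hz
    have h1 := hsub x z
    have h2 := hsub z x
    rw [dist_eq_norm] at hz
    have h3 := real_inner_le_norm ((gradHomeomorph hP).symm z - (gradHomeomorph hP).symm x)
      ((z : EuclideanSpace ℝ (Fin n)) - x)
    rw [← neg_sub (z : EuclideanSpace ℝ (Fin n)) (x : EuclideanSpace ℝ (Fin n)),
      inner_neg_right] at h2
    rw [inner_sub_left] at h3
    have h4 := mul_le_mul_of_nonneg_right hz (norm_nonneg ((z : EuclideanSpace ℝ (Fin n)) - x))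
    simp only [Function.comp_apply]
    rw [Real.norm_of_nonneg (by linarith)]
    linarith

theorem isEssSmooth_polyEntropy {v : Fin q → EuclideanSpace ℝ (Fin n)}
    (hP : (interior (convexHull ℝ (Set.range v))).Nonempty) : IsEssSmooth (polyEntropy v) := by
  refine ⟨by rwa [effDom_polyEntropy], ?_, ?_⟩
  · rw [effDom_polyEntropy]
    exact fun x hx => ⟨_, hasGradAt_polyEntropy hP ⟨x, hx⟩⟩
  · rw [effDom_polyEntropy]
    intro u g x hu hg hx hux
    have hgu : ∀ k, gradMap v (g k) = u k := fun k => by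
      rw [(hg k).unique (hasGradAt_polyEntropy hP ⟨u k, hu k⟩), gradMap_gradHomeomorph_symm]
    refine tendsto_atTop.2 fun C => ?_
    -- Gradients of norm at most `C` keep `u k` in a compact subset of `int P`, which misses a
    -- neighbourhood of the boundary point `x`.
    have hcl : IsClosed (gradMap v '' Metric.closedBall 0 C) :=
      ((isCompact_closedBall 0 C).image (continuous_gradMap v)).isClosed
    have hxn : x ∈ (gradMap v '' Metric.closedBall 0 C)ᶜ := by
      rintro ⟨y, -, rfl⟩
      exact hx.2 (gradMap_mem_interior hP y)
    filter_upwards [hux.eventually (hcl.isOpen_compl.mem_nhds hxn)] with k hk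
    by_contra! hC
    exact hk ⟨g k, mem_closedBall_zero_iff.2 hC.le, hgu k⟩

end PolyLegendre

open PolyLegendre in
theorem mainTheorem1 (n q : ℕ) (hn : 1 ≤ n) (hnq : n < q)
    (v : Fin q → EuclideanSpace ℝ (Fin n))
    (hP : (interior (convexHull ℝ (Set.range v))).Nonempty) :
    (IsLegendre (polyEntropy v) ∧ IsSuperlinear (polyEntropy v) ∧
      effDom (polyEntropy v) = convexHull ℝ (Set.range v)) ∧
    (∀ y, conjugate (polyEntropy v) y =
      conjugate (gibbs q) (mulVecE (vertexMatrix v).transpose y)) ∧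
    (∀ z : EuclideanSpace ℝ (Fin q),
      conjugate (gibbs q) z = ((Real.log (∑ i, Real.exp (z i)) : ℝ) : EReal) ∧
      HasGradAt (conjugate (gibbs q)) (softmax z) z) ∧
    ∃ Φ : EuclideanSpace ℝ (Fin n) ≃ₜ interior (convexHull ℝ (Set.range v)),
      (∀ y, (Φ y : EuclideanSpace ℝ (Fin n)) =
        mulVecE (vertexMatrix v) (softmax (mulVecE (vertexMatrix v).transpose y))) ∧
      (∀ y, HasGradAt (conjugate (polyEntropy v)) (Φ y) y ∧
        subdifferential (conjugate (polyEntropy v)) y =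
          {(Φ y : EuclideanSpace ℝ (Fin n))}) ∧
      (∀ x, HasGradAt (polyEntropy v) (Φ.symm x) x ∧
        subdifferential (polyEntropy v) x = {Φ.symm x}) := by
  have : NeZero q := ⟨by omega⟩
  have hne := hP.mono interior_subset
  refine ⟨⟨⟨isProperConvex_polyEntropy hne, isEssStrictlyConvex_polyEntropy hne,
    isEssSmooth_polyEntropy hP⟩, isSuperlinear_polyEntropy v, effDom_polyEntropy v⟩,
    fun y => by rw [mulVecE_vertexMatrix_transpose, conjugate_polyEntropy],
    fun z => ⟨conjugate_gibbs z, hasGradAt_conjugate_gibbs z⟩,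
    gradHomeomorph hP, fun y => ?_, fun y => ?_, fun x => ?_⟩
  · rw [mulVecE_vertexMatrix_transpose, mulVecE_vertexMatrix, coe_gradHomeomorph, gradMap]
  · rw [coe_gradHomeomorph]
    exact ⟨hasGradAt_conjugate_polyEntropy v y, subdifferential_conjugate_polyEntropy v y⟩
  · exact ⟨hasGradAt_polyEntropy hP x, subdifferential_eq_singleton (hasGradAt_polyEntropy hP x)
      (symm_mem_subdifferential_polyEntropy hP x)⟩
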